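/- Let $N$ be a $(2n+1)$-dimensional smooth manifold with an almost contact metric structure $(\phi,\xi,\eta,g)$, that is, $g$ is a Riemannian metric, $\phi$ a $(1,1)$-tensor field, $\xi$ a vector field and $\eta$ a $1$-form with $\phi^2X=-X+\eta(X)\xi$, $\phi\xi=0$, $\eta(\xi)=1$, $g(X,\xi)=\eta(X)$, $\eta(\phi X)=0$, $g(\phi X,\phi Y)=g(X,Y)-\eta(X)\eta(Y)$, $g(\phi X,Y)=-g(X,\phi Y)$. Suppose that $N$ is special quasi-Sasakian (SQ-Sasakian) with structure function $\beta$: $\beta$ is a smooth function on $N$ with $\xi\beta=0$, the fundamental form $\Phi(X,Y)=g(X,\phi Y)$ is closed, the structure is normal (i.e. $[\phi X,\phi Y]+\phi^2[X,Y]-\phi[\phi X,Y]-\phi[X,\phi Y]+2d\eta(X,Y)\xi=0$, where $2d\eta(X,Y)=X\eta(Y)-Y\eta(X)-\eta([X,Y])$), and $\bar\nabla_X\xi=-\beta\phi X$ for the Levi-Civita connection $\bar\nabla$ of $g$. Let $M$ be an invariant (immersed) submanifold of $N$ of dimension $2m+1$, i.e. $\xi$ is tangent to $M$ and $\phi(TM)\subset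 TM$, with the induced metric, again denoted $g$, and its Ricci tensor $S(Y,Z)=\operatorname{tr}(X\mapsto R(X,Y)Z)$, where $R(X,Y)Z=\nabla_X\nabla_YZ-\nabla_Y\nabla_XZ-\nabla_{[X,Y]}Z$. Let $\lambda\in\mathbb R$ be such that $(g,\xi,\lambda)$ is a Ricci soliton on $M$: $$\mathcal L_\xi g+2S+2\lambda g=0 \quad\text{on } M.$$ Then, at every point of $M$, $$S(\xi,\xi)=2m\beta^2\qquad\text{and}\qquad \lambda=-2m\beta^2 .$$ In particular, if $m\ge 1$ and $\beta$ does not vanish identically on $M$, then $\lambda<0$, i.e. the Ricci soliton is shrinking. -/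

import Mathlib

open Set Bundle FiberBundle VectorField
open scoped Manifold ContDiff Topology

set_option linter.unusedSectionVars false

noncomputable section

namespace SQSasaki

section LeviCivita

variable {E : Type*} [NormedAddCommGroup E] [NormedSpace ℝ E] [FiniteDimensional ℝ E]
  {H : Type*} [TopologicalSpace H] (I : ModelWithCorners ℝ E H)
  {M : Type*} [TopologicalSpace M] [ChartedSpace H M] [IsManifold I ∞ M]
  [RiemannianBundle (fun x : M ↦ TangentSpace I x)]
  [IsContMDiffRiemannianBundle I ∞ E (fun x : M ↦ TangentSpace I x)]

/-- The right-hand side of the Koszul formula for `⟨∇_X Y, Z⟩` at `x`. -/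
def koszul (Y X Z : Π x : M, TangentSpace I x) (x : M) : ℝ :=
  (1 / 2) * (mvfderiv I (fun y ↦ (inner ℝ (Y y) (Z y) : ℝ)) x (X x)
    + mvfderiv I (fun y ↦ (inner ℝ (Z y) (X y) : ℝ)) x (Y x)
    - mvfderiv I (fun y ↦ (inner ℝ (X y) (Y y) : ℝ)) x (Z x)
    + inner ℝ (mlieBracket I X Y x) (Z x)
    - inner ℝ (mlieBracket I Y Z x) (X x)
    + inner ℝ (mlieBracket I Z X x) (Y x))

variable {I}

theorem mdiff_inner {X Y : Π x : M, TangentSpace I x} {x : M}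
    (hX : MDiffAt (T% X) x) (hY : MDiffAt (T% Y) x) :
    MDifferentiableAt I 𝓘(ℝ, ℝ) (fun y ↦ (inner ℝ (X y) (Y y) : ℝ)) x :=
  MDifferentiableAt.inner_bundle (IB := I) (F := E) (E := fun x : M ↦ TangentSpace I x)
    (b := fun y ↦ y) (v := X) (w := Y) hX hY

theorem koszul_tensorial_direction {Y Z : Π x : M, TangentSpace I x} {x : M}
    (hY : MDiffAt (T% Y) x) (hZ : MDiffAt (T% Z) x) :
    TensorialAt I E (fun X ↦ koszul I Y X Z x) x where
  smul {f X} hf hX := by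
    have h1 := mvfderiv_fun_mul hf (mdiff_inner hZ hX)
    have h2 := mvfderiv_fun_mul hf (mdiff_inner hX hY)
    simp [koszul, inner_smul_left, inner_smul_right, h1, h2, mlieBracket_smul_left hf hX,
      mlieBracket_smul_right hf hX, inner_add_left]
    rw [real_inner_comm (Z x) (X x), real_inner_comm (Y x) (X x)]
    ring
  add {X X'} hX hX' := by
    have h1 := mvfderiv_fun_add (mdiff_inner hZ hX) (mdiff_inner hZ hX')
    have h2 := mvfderiv_fun_add (mdiff_inner hX hY) (mdiff_inner hX' hY)
    simp [koszul, inner_add_left, inner_add_right, h1, h2, mlieBracket_add_left hX hX',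
      mlieBracket_add_right hX hX']
    ring

theorem koszul_tensorial_test {Y X : Π x : M, TangentSpace I x} {x : M}
    (hY : MDiffAt (T% Y) x) (hX : MDiffAt (T% X) x) :
    TensorialAt I E (fun Z ↦ koszul I Y X Z x) x where
  smul {f Z} hf hZ := by
    have h1 := mvfderiv_fun_mul hf (mdiff_inner hY hZ)
    have h2 := mvfderiv_fun_mul hf (mdiff_inner hZ hX)
    simp [koszul, inner_smul_left, inner_smul_right, h1, h2, mlieBracket_smul_left hf hZ,
      mlieBracket_smul_right hf hZ, inner_add_left]
    rw [real_inner_comm (Y x) (Z x)]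
    ring
  add {Z Z'} hZ hZ' := by
    have h1 := mvfderiv_fun_add (mdiff_inner hY hZ) (mdiff_inner hY hZ')
    have h2 := mvfderiv_fun_add (mdiff_inner hZ hX) (mdiff_inner hZ' hX)
    simp [koszul, inner_add_left, inner_add_right, h1, h2, mlieBracket_add_left hZ hZ',
      mlieBracket_add_right hZ hZ']
    ring

instance instFiniteDimensionalTangentSpace (x : M) : FiniteDimensional ℝ (TangentSpace I x) :=
  inferInstanceAs (FiniteDimensional ℝ E)

open scoped Classical in
/-- The operator `Y ↦ ∇ Y` of the Levi-Civita connection: `⟨∇_X Y, Z⟩ = koszul Y X Z`, with the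
dummy value `0` at points where `Y` is not differentiable. -/
def leviCivitaFun (Y : Π x : M, TangentSpace I x) (x : M) :
    TangentSpace I x →L[ℝ] TangentSpace I x :=
  if hY : MDiffAt (T% Y) x then
    haveI : CompleteSpace (TangentSpace I x) := FiniteDimensional.complete ℝ _
    letI B : TangentSpace I x →L[ℝ] TangentSpace I x →L[ℝ] ℝ :=
      TensorialAt.mkHom₂ (fun X Z ↦ koszul I Y X Z x) x
        (fun _ hZ ↦ koszul_tensorial_direction hY hZ)
        (fun _ hX ↦ koszul_tensorial_test hY hX)
    LinearMap.toContinuousLinearMap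
      { toFun := fun v ↦ (InnerProductSpace.toDual ℝ (TangentSpace I x)).symm (B v)
        map_add' := fun v w ↦ by simp
        map_smul' := fun c v ↦ by simp }
  else 0

theorem inner_leviCivitaFun {Y X Z : Π x : M, TangentSpace I x} {x : M}
    (hY : MDiffAt (T% Y) x) (hX : MDiffAt (T% X) x) (hZ : MDiffAt (T% Z) x) :
    inner ℝ (leviCivitaFun Y x (X x)) (Z x) = koszul I Y X Z x := by
  have : CompleteSpace (TangentSpace I x) := FiniteDimensional.complete ℝ _
  rw [leviCivitaFun, dif_pos hY]
  simp only [LinearMap.coe_toContinuousLinearMap', LinearMap.coe_mk, AddHom.coe_mk,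
    InnerProductSpace.toDual_symm_apply]
  exact TensorialAt.mkHom₂_apply (V := fun x : M ↦ TangentSpace I x)
    (V' := fun x : M ↦ TangentSpace I x)
    (fun _ hZ ↦ koszul_tensorial_direction hY hZ)
    (fun _ hX ↦ koszul_tensorial_test hY hX) hX hZ

theorem eq_of_inner_fields {x : M} {A B : TangentSpace I x →L[ℝ] TangentSpace I x}
    (h : ∀ X Z : Π x : M, TangentSpace I x, MDiffAt (T% X) x → MDiffAt (T% Z) x →
      (inner ℝ (A (X x)) (Z x) : ℝ) = inner ℝ (B (X x)) (Z x)) : A = B := by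
  ext1 v
  refine ext_inner_right ℝ fun w ↦ ?_
  simpa using h (extend E v) (extend E w) (mdifferentiableAt_extend ..)
    (mdifferentiableAt_extend ..)

variable (I M) in
/-- The Levi-Civita connection of the Riemannian metric, `leviCivita I M Y x (X x) = (∇_X Y)(x)`.
That it is torsion-free and metric is `leviCivita_torsion_free` and `leviCivita_metric`. -/
def leviCivita : CovariantDerivative I E (fun x : M ↦ TangentSpace I x) where
  toFun := leviCivitaFun
  isCovariantDerivativeOnUniv :=
    { add := by
        intro Y Y' x hY hY' _
        have hYY' : MDiffAt (T% (Y + Y')) x := mdifferentiableAt_add_section hY hY'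
        refine eq_of_inner_fields fun X Z hX hZ ↦ ?_
        have h1 := mvfderiv_fun_add (mdiff_inner hY hZ) (mdiff_inner hY' hZ)
        have h2 := mvfderiv_fun_add (mdiff_inner hX hY) (mdiff_inner hX hY')
        rw [add_apply, inner_add_left, inner_leviCivitaFun hYY' hX hZ,
          inner_leviCivitaFun hY hX hZ, inner_leviCivitaFun hY' hX hZ]
        simp [koszul, inner_add_left, inner_add_right, h1, h2, mlieBracket_add_left hY hY',
          mlieBracket_add_right hY hY']
        ring
      leibniz := by
        intro Y f x hY hf _
        have hfY : MDiffAt (T% (f • Y)) x := hf.smul_section hY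
        refine eq_of_inner_fields fun X Z hX hZ ↦ ?_
        have h1 := mvfderiv_fun_mul hf (mdiff_inner hY hZ)
        have h2 := mvfderiv_fun_mul hf (mdiff_inner hX hY)
        rw [add_apply, inner_add_left, smul_apply,
          inner_smul_left, inner_leviCivitaFun hfY hX hZ, inner_leviCivitaFun hY hX hZ]
        simp [koszul, inner_smul_left, inner_smul_right, h1, h2, mlieBracket_smul_left hf hY,
          mlieBracket_smul_right hf hY, inner_add_left]
        rw [real_inner_comm (Y x) (X x)]
        ring }

/-- The Koszul formula. -/
theorem koszul_formula {Y X Z : Π x : M, TangentSpace I x} {x : M}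
    (hY : MDiffAt (T% Y) x) (hX : MDiffAt (T% X) x) (hZ : MDiffAt (T% Z) x) :
    inner ℝ (leviCivita I M Y x (X x)) (Z x) = koszul I Y X Z x :=
  inner_leviCivitaFun hY hX hZ

/-- The Levi-Civita connection is torsion-free: `∇_X Y - ∇_Y X = [X, Y]`. -/
theorem leviCivita_torsion_free {X Y : Π x : M, TangentSpace I x} {x : M}
    (hX : MDiffAt (T% X) x) (hY : MDiffAt (T% Y) x) :
    leviCivita I M Y x (X x) - leviCivita I M X x (Y x) = mlieBracket I X Y x := by
  refine ext_inner_right ℝ fun w ↦ ?_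
  have hZ : MDiffAt (T% (extend E w : Π y : M, TangentSpace I y)) x :=
    mdifferentiableAt_extend ..
  have h1 := koszul_formula hY hX hZ
  have h2 := koszul_formula hX hY hZ
  have e1 : mlieBracket I Y X x = - mlieBracket I X Y x := mlieBracket_swap_apply
  have e2 : mlieBracket I (extend E w) X x = - mlieBracket I X (extend E w) x :=
    mlieBracket_swap_apply
  have e3 : mlieBracket I (extend E w) Y x = - mlieBracket I Y (extend E w) x :=
    mlieBracket_swap_apply
  rw [extend_apply_self] at h1 h2
  rw [inner_sub_left, h1, h2]
  simp only [koszul, extend_apply_self, e1, e2, e3, inner_neg_left]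
  simp only [real_inner_comm]
  ring

/-- The Levi-Civita connection is metric: `X⟨Y, Z⟩ = ⟨∇_X Y, Z⟩ + ⟨Y, ∇_X Z⟩`. -/
theorem leviCivita_metric {X Y Z : Π x : M, TangentSpace I x} {x : M}
    (hX : MDiffAt (T% X) x) (hY : MDiffAt (T% Y) x) (hZ : MDiffAt (T% Z) x) :
    mvfderiv I (fun y ↦ (inner ℝ (Y y) (Z y) : ℝ)) x (X x) =
      inner ℝ (leviCivita I M Y x (X x)) (Z x) + inner ℝ (Y x) (leviCivita I M Z x (X x)) := by
  have e1 : mlieBracket I Y X x = - mlieBracket I X Y x := mlieBracket_swap_apply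
  have e2 : mlieBracket I Z X x = - mlieBracket I X Z x := mlieBracket_swap_apply
  have e3 : mlieBracket I Z Y x = - mlieBracket I Y Z x := mlieBracket_swap_apply
  have c1 : (fun y ↦ (inner ℝ (Z y) (Y y) : ℝ)) = fun y ↦ inner ℝ (Y y) (Z y) :=
    funext fun y ↦ real_inner_comm _ _
  have c2 : (fun y ↦ (inner ℝ (Z y) (X y) : ℝ)) = fun y ↦ inner ℝ (X y) (Z y) :=
    funext fun y ↦ real_inner_comm _ _
  have c3 : (fun y ↦ (inner ℝ (Y y) (X y) : ℝ)) = fun y ↦ inner ℝ (X y) (Y y) :=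
    funext fun y ↦ real_inner_comm _ _
  rw [real_inner_comm (leviCivita I M Z x (X x)) (Y x), koszul_formula hY hX hZ,
    koszul_formula hZ hX hY]
  simp only [koszul, e1, e2, e3, inner_neg_left, c1, c2, c3]
  ring

variable (I) in
/-- The curvature operator `R(X, Y)Z = ∇_X ∇_Y Z - ∇_Y ∇_X Z - ∇_[X, Y] Z`. -/
def curvature (X Y Z : Π x : M, TangentSpace I x) (x : M) : TangentSpace I x :=
  leviCivita I M (fun y ↦ leviCivita I M Z y (Y y)) x (X x)
    - leviCivita I M (fun y ↦ leviCivita I M Z y (X y)) x (Y x)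
    - leviCivita I M Z x (mlieBracket I X Y x)

variable (I) in
/-- The Ricci tensor `S(v, w) = tr (u ↦ R(u, v)w)` at `x`: the trace is taken in an orthonormal
basis of the tangent space, and tangent vectors are extended to vector fields that are smooth
near `x` in order to evaluate the (tensorial) curvature operator. -/
def ricci (x : M) (v w : TangentSpace I x) : ℝ :=
  ∑ i, inner ℝ
    (curvature I (extend E (stdOrthonormalBasis ℝ (TangentSpace I x) i)) (extend E v)
      (extend E w) x)
    (stdOrthonormalBasis ℝ (TangentSpace I x) i)

variable (I) in
/-- `X` is a smooth vector field on `M`. -/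
def IsSmoothField (X : Π x : M, TangentSpace I x) : Prop :=
  ContMDiff I I.tangent ∞ (fun x ↦ (⟨x, X x⟩ : TangentBundle I M))

variable (I) in
/-- The Lie derivative of the metric along `V`:
`(ℒ_V g)(Y, Z) = V(g(Y, Z)) - g([V, Y], Z) - g(Y, [V, Z])`. -/
def lieDerivMetric (V Y Z : Π x : M, TangentSpace I x) (x : M) : ℝ :=
  mvfderiv I (fun y ↦ (inner ℝ (Y y) (Z y) : ℝ)) x (V x)
    - inner ℝ (mlieBracket I V Y x) (Z x) - inner ℝ (Y x) (mlieBracket I V Z x)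

variable (I) in
/-- `(g, V, lam)` is a Ricci soliton on `M`: `V` is a smooth vector field and
`ℒ_V g + 2 S + 2 lam g = 0`, where `g` is the given Riemannian metric. -/
structure IsRicciSoliton (V : Π x : M, TangentSpace I x) (lam : ℝ) : Prop where
  smooth : IsSmoothField I V
  equation : ∀ Y Z : Π x : M, TangentSpace I x, IsSmoothField I Y → IsSmoothField I Z → ∀ x : M,
    lieDerivMetric I V Y Z x + 2 * ricci I x (Y x) (Z x) + 2 * lam * inner ℝ (Y x) (Z x) = 0

variable (I M) in
/-- An almost contact metric structure `(φ, ξ, η, g)` on `M`, where `g` is the given Riemannian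
metric. (Smoothness of `η` follows from that of `ξ` and `g` by `inner_xi`.) -/
structure AlmostContactMetricStructure where
  /-- the `(1,1)`-tensor field -/
  phi : Π x : M, TangentSpace I x →L[ℝ] TangentSpace I x
  /-- the structure vector field -/
  xi : Π x : M, TangentSpace I x
  /-- the `1`-form -/
  eta : Π x : M, TangentSpace I x →L[ℝ] ℝ
  smooth_phi : ContMDiff I (I.prod 𝓘(ℝ, E →L[ℝ] E)) ∞
    (fun x ↦ TotalSpace.mk' (E →L[ℝ] E)
      (E := fun x : M ↦ TangentSpace I x →L[ℝ] TangentSpace I x) x (phi x))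
  smooth_xi : IsSmoothField I xi
  phi_phi : ∀ x (u : TangentSpace I x), phi x (phi x u) = -u + eta x u • xi x
  phi_xi : ∀ x, phi x (xi x) = 0
  eta_xi : ∀ x, eta x (xi x) = 1
  inner_xi : ∀ x (u : TangentSpace I x), inner ℝ u (xi x) = eta x u
  eta_phi : ∀ x (u : TangentSpace I x), eta x (phi x u) = 0
  inner_phi_phi : ∀ x (u v : TangentSpace I x),
    (inner ℝ (phi x u) (phi x v) : ℝ) = inner ℝ u v - eta x u * eta x v
  inner_phi_left : ∀ x (u v : TangentSpace I x),
    (inner ℝ (phi x u) v : ℝ) = - inner ℝ u (phi x v)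

namespace AlmostContactMetricStructure

variable (A : AlmostContactMetricStructure I M)

/-- The vector field `φX`. -/
def phiField (X : Π x : M, TangentSpace I x) : Π x : M, TangentSpace I x :=
  fun x ↦ A.phi x (X x)

/-- The fundamental `2`-form `Φ(X, Y) = g(X, φY)`. -/
def fundamentalForm (X Y : Π x : M, TangentSpace I x) (x : M) : ℝ :=
  inner ℝ (X x) (A.phi x (Y x))

/-- `dΦ = 0`, by the invariant formula for the exterior derivative of a `2`-form. -/
def FundamentalFormClosed : Prop :=
  ∀ X Y Z : Π x : M, TangentSpace I x,
    IsSmoothField I X → IsSmoothField I Y → IsSmoothField I Z → ∀ x : M,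
      mvfderiv I (A.fundamentalForm Y Z) x (X x)
        + mvfderiv I (A.fundamentalForm Z X) x (Y x)
        + mvfderiv I (A.fundamentalForm X Y) x (Z x)
        - A.fundamentalForm (mlieBracket I X Y) Z x
        - A.fundamentalForm (mlieBracket I Y Z) X x
        - A.fundamentalForm (mlieBracket I Z X) Y x = 0

/-- `2 dη(X, Y) = X(η(Y)) - Y(η(X)) - η([X, Y])`, with the normalization of `d` that is usual in
contact metric geometry. -/
def twoDEta (X Y : Π x : M, TangentSpace I x) (x : M) : ℝ :=
  mvfderiv I (fun y ↦ A.eta y (Y y)) x (X x) - mvfderiv I (fun y ↦ A.eta y (X y)) x (Y x)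
    - A.eta x (mlieBracket I X Y x)

/-- `N(X, Y) = [φX, φY] + φ²[X, Y] - φ[φX, Y] - φ[X, φY] + 2 dη(X, Y) ξ`. -/
def nijenhuis (X Y : Π x : M, TangentSpace I x) (x : M) : TangentSpace I x :=
  mlieBracket I (A.phiField X) (A.phiField Y) x
    + A.phi x (A.phi x (mlieBracket I X Y x))
    - A.phi x (mlieBracket I (A.phiField X) Y x)
    - A.phi x (mlieBracket I X (A.phiField Y) x)
    + A.twoDEta X Y x • A.xi x

/-- The structure `(φ, ξ, η)` is normal: the tensor `N` vanishes. -/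
def IsNormal : Prop :=
  ∀ X Y : Π x : M, TangentSpace I x, IsSmoothField I X → IsSmoothField I Y →
    ∀ x : M, A.nijenhuis X Y x = 0

/-- The almost contact metric structure is special quasi-Sasakian (SQ-Sasakian) with structure
function `β`. -/
structure IsSQSasakian (β : M → ℝ) : Prop where
  smooth_beta : ContMDiff I 𝓘(ℝ, ℝ) ∞ β
  xi_beta : ∀ x : M, mvfderiv I β x (A.xi x) = 0
  closed : A.FundamentalFormClosed
  normal : A.IsNormal
  nabla_xi : ∀ (x : M) (u : TangentSpace I x), leviCivita I M A.xi x u = -(β x • A.phi x u)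

end AlmostContactMetricStructure

end LeviCivita

section Submanifold

variable {E : Type*} [NormedAddCommGroup E] [NormedSpace ℝ E] [FiniteDimensional ℝ E]
  {H : Type*} [TopologicalSpace H] (I : ModelWithCorners ℝ E H)
  {N : Type*} [TopologicalSpace N] [ChartedSpace H N] [IsManifold I ∞ N]
  [RiemannianBundle (fun x : N ↦ TangentSpace I x)]
  [IsContMDiffRiemannianBundle I ∞ E (fun x : N ↦ TangentSpace I x)]
  {E' : Type*} [NormedAddCommGroup E'] [NormedSpace ℝ E']
  {H' : Type*} [TopologicalSpace H'] (J : ModelWithCorners ℝ E' H')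
  {M : Type*} [TopologicalSpace M] [ChartedSpace H' M]

/-- `ι : M → N` exhibits `M` as an (immersed) submanifold of the Riemannian manifold `N`, and the
given Riemannian metric of `M` is the induced one. -/
structure IsRiemannianSubmanifold [RiemannianBundle (fun x : M ↦ TangentSpace J x)]
    (ι : M → N) : Prop where
  immersion : Manifold.IsImmersion J I ∞ ι
  induced_metric : ∀ (p : M) (u v : TangentSpace J p),
    (inner ℝ (mfderiv J I ι p u) (mfderiv J I ι p v) : ℝ) = inner ℝ u v

variable {I}

/-- The submanifold `ι : M → N` is invariant: `ξ` is tangent to `M` and `φ(TM) ⊆ TM`. -/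
structure IsInvariantSubmanifold (A : AlmostContactMetricStructure I N) (ι : M → N) : Prop where
  xi_tangent : ∀ p : M, A.xi (ι p) ∈ range (mfderiv J I ι p)
  phi_tangent : ∀ (p : M) (u : TangentSpace J p),
    A.phi (ι p) (mfderiv J I ι p u) ∈ range (mfderiv J I ι p)

variable {J}

/-- The structure vector field `ξ`, regarded as a vector field on the invariant submanifold. -/
def IsInvariantSubmanifold.xi {A : AlmostContactMetricStructure I N} {ι : M → N}
    (h : IsInvariantSubmanifold J A ι) (p : M) : TangentSpace J p :=
  (h.xi_tangent p).choose

theorem IsInvariantSubmanifold.mfderiv_xi {A : AlmostContactMetricStructure I N} {ι : M → N}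
    (h : IsInvariantSubmanifold J A ι) (p : M) : mfderiv J I ι p (h.xi p) = A.xi (ι p) :=
  (h.xi_tangent p).choose_spec

end Submanifold

end SQSasaki

end

open SQSasaki

noncomputable section

namespace SQSasaki

section DirectionalDerivative

variable {E : Type*} [NormedAddCommGroup E] [NormedSpace ℝ E]
  {H : Type*} [TopologicalSpace H] {I : ModelWithCorners ℝ E H}
  {M : Type*} [TopologicalSpace M] [ChartedSpace H M] [IsManifold I ∞ M]

/-- The directional derivative of a `C²` function along a differentiable vector field is
differentiable. -/
theorem mdifferentiableAt_mvfderiv_apply {f : M → ℝ} {W : Π x : M, TangentSpace I x} {x : M}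
    (hf : ContMDiffAt I 𝓘(ℝ, ℝ) 2 f x) (hW : MDiffAt (T% W) x) :
    MDifferentiableAt I 𝓘(ℝ, ℝ) (fun y ↦ mvfderiv I f y (W y)) x := by
  have h1 := (hf.mfderiv_const (m := 1) le_rfl).mdifferentiableAt one_ne_zero
  have := MDifferentiableAt.clm_apply_of_inCoordinates (b₁ := id) (b₂ := f)
    (ϕ := fun y ↦ mfderiv I 𝓘(ℝ, ℝ) f y) (v := W) h1 hW (hf.mdifferentiableAt two_ne_zero)
  rw [mdifferentiableAt_totalSpace] at this
  have h2 := this.2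
  simpa using! h2

theorem fderivWithin_comp_extChartAt_symm {f : M → ℝ} {x : M} (V : Π x : M, TangentSpace I x)
    {z : E} (hz : z ∈ (extChartAt I x).target)
    (hf : MDifferentiableAt I 𝓘(ℝ, ℝ) f ((extChartAt I x).symm z)) :
    (fderivWithin ℝ (f ∘ (extChartAt I x).symm) (range I) z : E →L[ℝ] ℝ)
        (mpullbackWithin 𝓘(ℝ, E) I (extChartAt I x).symm V (range I) z) =
      mvfderiv I f ((extChartAt I x).symm z) (V ((extChartAt I x).symm z)) := by
  have hu : UniqueMDiffWithinAt 𝓘(ℝ, E) (range I) z :=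
    I.uniqueMDiffOn _ (extChartAt_target_subset_range x hz)
  have h1 := mfderiv_comp_mfderivWithin z hf (mdifferentiableWithinAt_extChartAt_symm hz) hu
  rw [mfderivWithin_eq_fderivWithin] at h1
  have h2 := (isInvertible_mfderivWithin_extChartAt_symm hz).self_apply_inverse
    (V ((extChartAt I x).symm z))
  have h3 := congrArg (mfderiv I 𝓘(ℝ, ℝ) f ((extChartAt I x).symm z)) h2
  exact (DFunLike.congr_fun h1 _).trans h3

theorem mvfderiv_apply_eq_fderivWithin {f : M → ℝ} {x : M} (V : Π x : M, TangentSpace I x)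
    (hf : MDifferentiableAt I 𝓘(ℝ, ℝ) f x) :
    mvfderiv I f x (V x) =
      (fderivWithin ℝ (f ∘ (extChartAt I x).symm) (range I) (extChartAt I x x) : E →L[ℝ] ℝ)
        (mpullbackWithin 𝓘(ℝ, E) I (extChartAt I x).symm V (range I) (extChartAt I x x)) := by
  rw [fderivWithin_comp_extChartAt_symm V (mem_extChartAt_target x)
    (by rwa [extChartAt_to_inv]), extChartAt_to_inv]

theorem mpullbackWithin_extChartAt_symm_self (x : M) (U : Π x : M, TangentSpace I x) :
    (mpullbackWithin 𝓘(ℝ, E) I (extChartAt I x).symm U (range I) (extChartAt I x x) : E) =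
      U x := by
  refine (mfderivWithin_extChartAt_symm_inverse_apply (x := x)
    (U ((extChartAt I x).symm (extChartAt I x x)))).trans ?_
  rw [extChartAt_to_inv]

/-- Differentiation along the Lie bracket is the commutator of directional derivatives. -/
theorem mvfderiv_mlieBracket_apply [CompleteSpace E] {f : M → ℝ} {V W : Π x : M, TangentSpace I x}
    {x : M} (hf : ContMDiffAt I 𝓘(ℝ, ℝ) 2 f x) (hV : MDiffAt (T% V) x) (hW : MDiffAt (T% W) x) :
    mvfderiv I f x (mlieBracket I V W x) =
      mvfderiv I (fun y ↦ mvfderiv I f y (W y)) x (V x)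
        - mvfderiv I (fun y ↦ mvfderiv I f y (V y)) x (W x) := by
  have hs : ContDiffWithinAt ℝ 2 (f ∘ (extChartAt I x).symm) (range I) (extChartAt I x x) :=
    (contMDiffAt_iff.1 hf).2
  have hev : ∀ᶠ y in 𝓝 x, MDifferentiableAt I 𝓘(ℝ, ℝ) f y := by
    filter_upwards [(contMDiffAt_iff_contMDiffAt_nhds (by simp)).1 hf] with y hy
    exact ContMDiffAt.mdifferentiableAt hy two_ne_zero
  have hev' : ∀ᶠ z in 𝓝[range I] (extChartAt I x x), z ∈ (extChartAt I x).target ∧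
      MDifferentiableAt I 𝓘(ℝ, ℝ) f ((extChartAt I x).symm z) := by
    refine Filter.Eventually.and (extChartAt_target_mem_nhdsWithin x) ?_
    have h := (continuousAt_extChartAt_symm (I := I) x).tendsto
    rw [extChartAt_to_inv] at h
    exact (h.mono_left nhdsWithin_le_nhds).eventually hev
  have key : ∀ U : Π x : M, TangentSpace I x,
      (fun y ↦ mvfderiv I f y (U y)) ∘ (extChartAt I x).symm =ᶠ[𝓝[range I] (extChartAt I x x)]
        fun z ↦ (fderivWithin ℝ (f ∘ (extChartAt I x).symm) (range I) z : E →L[ℝ] ℝ)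
          (mpullbackWithin 𝓘(ℝ, E) I (extChartAt I x).symm U (range I) z) := by
    intro U
    filter_upwards [hev'] with z hz
    exact (fderivWithin_comp_extChartAt_symm U hz.1 hz.2).symm
  have hmem : extChartAt I x x ∈ range I := mem_range_self _
  rw [mvfderiv_apply_eq_fderivWithin V (mdifferentiableAt_mvfderiv_apply hf hW),
    mvfderiv_apply_eq_fderivWithin W (mdifferentiableAt_mvfderiv_apply hf hV),
    mvfderiv_apply_eq_fderivWithin (mlieBracket I V W) (hf.mdifferentiableAt two_ne_zero),
    (key V).fderivWithin_eq_of_mem hmem, (key W).fderivWithin_eq_of_mem hmem]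
  rw [← mdifferentiableWithinAt_univ] at hV hW
  have hV' := hV.differentiableWithinAt_mpullbackWithin_vectorField
  have hW' := hW.differentiableWithinAt_mpullbackWithin_vectorField
  simp only [preimage_univ, univ_inter] at hV' hW'
  rw [← fderivWithin_apply_lieBracket hs (by simp) I.uniqueDiffOn
    (I.range_subset_closure_interior hmem) hmem hW' hV']
  congr 1
  refine (mpullbackWithin_extChartAt_symm_self x _).trans ?_
  rw [mlieBracket, mlieBracketWithin_apply, mfderiv_extChartAt_self]
  simp only [preimage_univ, univ_inter]
  change (ContinuousLinearMap.id ℝ E).inverse _ = _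
  rw [ContinuousLinearMap.inverse_id]
  rfl

end DirectionalDerivative

section RelatedFields

variable {E : Type*} [NormedAddCommGroup E] [NormedSpace ℝ E]
  {H : Type*} [TopologicalSpace H] {I : ModelWithCorners ℝ E H}
  {N : Type*} [TopologicalSpace N] [ChartedSpace H N] [IsManifold I ∞ N]
  {E' : Type*} [NormedAddCommGroup E'] [NormedSpace ℝ E']
  {H' : Type*} [TopologicalSpace H'] {J : ModelWithCorners ℝ E' H'}
  {M : Type*} [TopologicalSpace M] [ChartedSpace H' M] [IsManifold J ∞ M]
  {ι : M → N} {p : M}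

theorem eventually_mdifferentiableAt (hι : ContMDiffAt J I 2 ι p) :
    ∀ᶠ y in 𝓝 p, MDifferentiableAt J I ι y := by
  filter_upwards [(contMDiffAt_iff_contMDiffAt_nhds (by simp)).1 hι] with y hy
  exact ContMDiffAt.mdifferentiableAt hy two_ne_zero

/-- Directional derivatives along `ι`-related vector fields agree. -/
theorem mvfderiv_comp_eventuallyEq {f : N → ℝ} {W : Π x : M, TangentSpace J x}
    {W' : Π x : N, TangentSpace I x} (hι : ContMDiffAt J I 2 ι p)
    (hf : ContMDiffAt I 𝓘(ℝ, ℝ) 2 f (ι p))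
    (hW : ∀ᶠ y in 𝓝 p, mfderiv J I ι y (W y) = W' (ι y)) :
    (fun y ↦ mvfderiv J (f ∘ ι) y (W y)) =ᶠ[𝓝 p]
      (fun z ↦ mvfderiv I f z (W' z)) ∘ ι := by
  filter_upwards [hW, eventually_mdifferentiableAt hι,
    hι.continuousAt.eventually (eventually_mdifferentiableAt hf)] with y hy hιy hfy
  rw [mvfderiv_comp_apply y hfy hιy, hy]
  rfl

/-- The Lie brackets of `ι`-related vector fields are `ι`-related. -/
theorem mfderiv_mlieBracket_of_related [CompleteSpace E] [CompleteSpace E']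
    {V W : Π x : M, TangentSpace J x} {V' W' : Π x : N, TangentSpace I x}
    (hι : ContMDiffAt J I 2 ι p)
    (hV : MDiffAt (T% V) p) (hW : MDiffAt (T% W) p)
    (hV' : MDiffAt (T% V') (ι p)) (hW' : MDiffAt (T% W') (ι p))
    (hVV' : ∀ᶠ y in 𝓝 p, mfderiv J I ι y (V y) = V' (ι y))
    (hWW' : ∀ᶠ y in 𝓝 p, mfderiv J I ι y (W y) = W' (ι y)) :
    mfderiv J I ι p (mlieBracket J V W p) = mlieBracket I V' W' (ι p) := by
  have hιp := hι.mdifferentiableAt two_ne_zero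
  have key : ∀ l : E →L[ℝ] ℝ,
      l (mfderiv J I ι p (mlieBracket J V W p)) = l (mlieBracket I V' W' (ι p)) := by
    intro l
    have hφ : ContMDiffAt I 𝓘(ℝ, E) 2 (extChartAt I (ι p)) (ι p) := contMDiffAt_extChartAt
    have hf : ContMDiffAt I 𝓘(ℝ, ℝ) 2 (l ∘ extChartAt I (ι p)) (ι p) :=
      l.contMDiff.contMDiffAt.comp _ hφ
    have hl : ∀ w : TangentSpace I (ι p), mvfderiv I (l ∘ extChartAt I (ι p)) (ι p) w = l w := by
      intro w
      have h := mfderiv_comp_apply (ι p) (l.mdifferentiableAt (x := extChartAt I (ι p) (ι p)))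
        (hφ.mdifferentiableAt two_ne_zero) w
      rw [mfderiv_extChartAt_self, ContinuousLinearMap.mfderiv_eq] at h
      exact h
    rw [← hl, ← hl, mvfderiv_mlieBracket_apply hf hV' hW',
      ← mvfderiv_comp_apply p (hf.mdifferentiableAt two_ne_zero) hιp,
      mvfderiv_mlieBracket_apply (hf.comp p hι) hV hW]
    have aux : ∀ {U U₁ : Π x : M, TangentSpace J x} {U' U₁' : Π x : N, TangentSpace I x},
        MDiffAt (T% U') (ι p) → (∀ᶠ y in 𝓝 p, mfderiv J I ι y (U y) = U' (ι y)) →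
        (∀ᶠ y in 𝓝 p, mfderiv J I ι y (U₁ y) = U₁' (ι y)) →
        mvfderiv J (fun y ↦ mvfderiv J ((l ∘ extChartAt I (ι p)) ∘ ι) y (U y)) p (U₁ p) =
          mvfderiv I (fun z ↦ mvfderiv I (l ∘ extChartAt I (ι p)) z (U' z)) (ι p)
            (U₁' (ι p)) := by
      intro U U₁ U' U₁' hU' hU hU₁
      rw [← hU₁.self_of_nhds, ← mvfderiv_comp_apply p (mdifferentiableAt_mvfderiv_apply hf hU') hιp,
        mvfderiv, mvfderiv, (mvfderiv_comp_eventuallyEq hι hf hU).mfderiv_eq]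
      rfl
    rw [aux hW' hWW' hVV', aux hV' hVV' hWW']
  exact (SeparatingDual.eq_iff_forall_dual_eq (R := ℝ) (V := E)).2 key

end RelatedFields

section Immersion

variable {E : Type*} [NormedAddCommGroup E] [NormedSpace ℝ E]
  {H : Type*} [TopologicalSpace H] {I : ModelWithCorners ℝ E H}
  {N : Type*} [TopologicalSpace N] [ChartedSpace H N]

theorem mfderiv_extend_isInvertible {e : OpenPartialHomeomorph N H}
    (he : e ∈ IsManifold.maximalAtlas I ∞ N) {x : N} (hx : x ∈ e.source) :
    (mfderiv I 𝓘(ℝ, E) (e.extend I) x).IsInvertible := by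
  have hd : e.MDifferentiable I I :=
    ⟨(contMDiffOn_of_mem_maximalAtlas he).mdifferentiableOn (by simp),
      (contMDiffOn_symm_of_mem_maximalAtlas he).mdifferentiableOn (by simp)⟩
  have h : HasMFDerivAt I 𝓘(ℝ, E) (e.extend I) x (mfderiv I I e x :) :=
    I.hasMFDerivAt.comp x (hd.mdifferentiableAt hx).hasMFDerivAt
  rw [h.mfderiv]
  exact ⟨hd.mfderiv hx, rfl⟩

variable [IsManifold I ∞ N] [CompleteSpace E]

/-- Pulling back a constant vector field by a chart gives a differentiable vector field. -/
theorem mdifferentiableAt_mpullback_const {e : OpenPartialHomeomorph N H}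
    (he : e ∈ IsManifold.maximalAtlas I ∞ N) {x : N} (hx : x ∈ e.source) (c : E) :
    MDiffAt (T% (mpullback I 𝓘(ℝ, E) (e.extend I) (fun _ ↦ c))) x := by
  have hc : MDifferentiableAt 𝓘(ℝ, E) 𝓘(ℝ, E).tangent
      (fun z : E ↦ (⟨z, c⟩ : TangentBundle 𝓘(ℝ, E) E)) (e.extend I x) := by
    rw [mdifferentiableAt_totalSpace]
    exact ⟨mdifferentiableAt_id, by simpa using! mdifferentiableAt_const⟩
  exact hc.mpullback_vectorField (n := 2) ((e.contMDiffAt_extend he hx).of_le ENat.LEInfty.out)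
    (mfderiv_extend_isInvertible he hx) le_rfl

variable
  {E' : Type*} [NormedAddCommGroup E'] [NormedSpace ℝ E'] [CompleteSpace E']
  {H' : Type*} [TopologicalSpace H'] {J : ModelWithCorners ℝ E' H'}
  {M : Type*} [TopologicalSpace M] [ChartedSpace H' M] [IsManifold J ∞ M]
  {ι : M → N} {p : M}

/-- A tangent vector at a point of an immersed submanifold extends to a pair of related vector
fields. -/
theorem exists_related_fields (hι : Manifold.IsImmersionAt J I ∞ ι p) (u : TangentSpace J p) :
    ∃ (X : Π x : M, TangentSpace J x) (X' : Π x : N, TangentSpace I x),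
      MDiffAt (T% X) p ∧ MDiffAt (T% X') (ι p) ∧ X p = u ∧
        ∀ᶠ y in 𝓝 p, mfderiv J I ι y (X y) = X' (ι y) := by
  set e := hι.domChart
  set e' := hι.codChart
  let L : E' →L[ℝ] E := (hι.equiv : (E' × hι.complement) →L[ℝ] E).comp
    (ContinuousLinearMap.inl ℝ E' hι.complement)
  set c : E' := mfderiv J 𝓘(ℝ, E') (e.extend J) p u
  have hrel : ∀ y ∈ e.source, e'.extend I (ι y) = L (e.extend J y) := by
    intro y hy
    have hy' : y ∈ (e.extend J).source := by simpa using hy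
    have h := hι.writtenInCharts ((e.extend J).map_source hy')
    simp only [Function.comp_apply] at h
    rw [(e.extend J).left_inv hy'] at h
    exact h
  have he := hι.domChart_mem_maximalAtlas
  have he' := hι.codChart_mem_maximalAtlas
  refine ⟨mpullback J 𝓘(ℝ, E') (e.extend J) (fun _ ↦ c),
    mpullback I 𝓘(ℝ, E) (e'.extend I) (fun _ ↦ L c),
    mdifferentiableAt_mpullback_const he hι.mem_domChart_source c,
    mdifferentiableAt_mpullback_const he' hι.mem_codChart_source (L c), ?_, ?_⟩
  · exact (mfderiv_extend_isInvertible he hι.mem_domChart_source).inverse_apply_self u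
  · have hcont : ContMDiffAt J I 2 ι p := hι.contMDiffAt.of_le ENat.LEInfty.out
    filter_upwards [e.open_source.mem_nhds hι.mem_domChart_source,
      eventually_mdifferentiableAt hcont] with y hy hιy
    have hy' : ι y ∈ e'.source := hι.source_subset_preimage_source hy
    have hinv := mfderiv_extend_isInvertible he' hy'
    apply hinv.injective
    refine Eq.trans ?_ (hinv.self_apply_inverse _).symm
    rw [← mfderiv_comp_apply y ((e'.contMDiffAt_extend he' hy').mdifferentiableAt (by simp)) hιy]
    have heq : e'.extend I ∘ ι =ᶠ[𝓝 y] L ∘ e.extend J :=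
      Filter.eventuallyEq_of_mem (e.open_source.mem_nhds hy) hrel
    rw [heq.mfderiv_eq]
    have h := mfderiv_comp_apply y (L.mdifferentiableAt (x := e.extend J y))
      ((e.contMDiffAt_extend he hy).mdifferentiableAt (by simp))
      (mpullback J 𝓘(ℝ, E') (e.extend J) (fun _ ↦ c) y)
    refine h.trans ?_
    rw [ContinuousLinearMap.mfderiv_eq]
    exact congrArg L ((mfderiv_extend_isInvertible he hy).self_apply_inverse c)

end Immersion

section MetricDual

variable {E : Type*} [NormedAddCommGroup E] [NormedSpace ℝ E] [FiniteDimensional ℝ E]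
  {H : Type*} [TopologicalSpace H] {I : ModelWithCorners ℝ E H}
  {M : Type*} [TopologicalSpace M] [ChartedSpace H M] [IsManifold I ∞ M]
  [RiemannianBundle (fun x : M ↦ TangentSpace I x)]
  [IsContMDiffRiemannianBundle I ∞ E (fun x : M ↦ TangentSpace I x)]

/-- The operator of `ℝⁿ` given by the Gram matrix of a family of tangent vectors. -/
def gramOperator {n : ℕ} {x : M} (v : Fin n → TangentSpace I x) :
    (Fin n → ℝ) →L[ℝ] (Fin n → ℝ) :=
  LinearMap.toContinuousLinearMap (Matrix.toLin' (Matrix.of fun i j ↦ (inner ℝ (v j) (v i) : ℝ)))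

theorem gramOperator_apply {n : ℕ} {x : M} (v : Fin n → TangentSpace I x) (c : Fin n → ℝ)
    (i : Fin n) : gramOperator v c i = inner ℝ (∑ j, c j • v j) (v i) := by
  simp [gramOperator, Matrix.mulVec, dotProduct, sum_inner, inner_smul_left, mul_comm]

theorem gramOperator_isInvertible {n : ℕ} {x : M} {v : Fin n → TangentSpace I x}
    (hv : LinearIndependent ℝ v) : (gramOperator v).IsInvertible := by
  have hinj : Function.Injective (gramOperator v) := by
    rw [injective_iff_map_eq_zero]
    intro c hc
    have h0 : (inner ℝ (∑ j, c j • v j) (∑ i, c i • v i) : ℝ) = 0 := by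
      rw [inner_sum]
      refine Finset.sum_eq_zero fun i _ ↦ ?_
      rw [inner_smul_right, ← gramOperator_apply, hc]
      simp
    funext i
    exact Fintype.linearIndependent_iff.1 hv c (inner_self_eq_zero.1 h0) i
  exact ⟨(LinearEquiv.ofInjectiveEndo (gramOperator v).toLinearMap hinj).toContinuousLinearEquiv,
    by ext; rfl⟩

theorem mdifferentiableAt_pi {κ : Type*} [Fintype κ] {F : κ → Type*}
    [∀ i, NormedAddCommGroup (F i)] [∀ i, NormedSpace ℝ (F i)] {f : M → ∀ i, F i} {x : M} :
    MDifferentiableAt I 𝓘(ℝ, ∀ i, F i) f x ↔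
      ∀ i, MDifferentiableAt I 𝓘(ℝ, F i) (fun y ↦ f y i) x := by
  simp only [mdifferentiableAt_iff, continuousAt_pi, forall_and]
  refine and_congr Iff.rfl ?_
  exact differentiableWithinAt_pi

theorem mdifferentiableAt_gramOperator {n : ℕ} {v : Fin n → Π x : M, TangentSpace I x} {x : M}
    (hv : ∀ i, MDiffAt (T% (v i)) x) :
    MDifferentiableAt I 𝓘(ℝ, (Fin n → ℝ) →L[ℝ] (Fin n → ℝ))
      (fun y ↦ gramOperator fun i ↦ v i y) x := by
  have hm : MDifferentiableAt I 𝓘(ℝ, Fin n → Fin n → ℝ)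
      (fun y i j ↦ (inner ℝ (v j y) (v i y) : ℝ)) x :=
    mdifferentiableAt_pi.2 fun i ↦ mdifferentiableAt_pi.2 fun j ↦ mdiff_inner (hv j) (hv i)
  let T : (Fin n → Fin n → ℝ) →ₗ[ℝ] (Fin n → ℝ) →L[ℝ] (Fin n → ℝ) :=
    LinearMap.toContinuousLinearMap.toLinearMap ∘ₗ
      (Matrix.toLin' (R := ℝ) (m := Fin n) (n := Fin n)).toLinearMap ∘ₗ
        (Matrix.ofLinearEquiv ℝ (m := Fin n) (n := Fin n) (α := ℝ)).toLinearMap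
  exact (LinearMap.toContinuousLinearMap T).mdifferentiableAt.comp x hm

/-- A vector field whose inner products with smooth fields are differentiable is itself
differentiable. -/
theorem mdifferentiableAt_of_inner {s : Π x : M, TangentSpace I x} {x : M}
    (h : ∀ Z : Π x : M, TangentSpace I x, ContMDiffAt I I.tangent ∞ (T% Z) x →
      MDifferentiableAt I 𝓘(ℝ, ℝ) (fun y ↦ (inner ℝ (s y) (Z y) : ℝ)) x) :
    MDiffAt (T% s) x := by
  set e := trivializationAt E (TangentSpace I : M → Type _) x
  let n := Module.finrank ℝ E
  let b : Module.Basis (Fin n) ℝ E := Module.finBasis ℝ E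
  have hx : x ∈ e.baseSet := mem_baseSet_trivializationAt' x
  have hF : ∀ i, ContMDiffAt I I.tangent ∞ (T% (e.localFrame b i)) x := fun i ↦
    contMDiffAt_localFrame_of_mem (I := I) ∞ e b i hx
  have hF1 : ∀ i, MDiffAt (T% (e.localFrame b i)) x := fun i ↦ (hF i).mdifferentiableAt (by simp)
  have hind : ∀ y ∈ e.baseSet, LinearIndependent ℝ fun i ↦ e.localFrame b i y := fun y hy ↦
    (e.isLocalFrameOn_localFrame_baseSet I 1 b).linearIndependent hy
  let c : M → Fin n → ℝ := fun y i ↦ e.localFrameCoeff I b i y (s y)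
  let r : M → Fin n → ℝ := fun y i ↦ inner ℝ (s y) (e.localFrame b i y)
  let G : M → (Fin n → ℝ) →L[ℝ] (Fin n → ℝ) := fun y ↦ gramOperator fun i ↦ e.localFrame b i y
  have hr : MDifferentiableAt I 𝓘(ℝ, Fin n → ℝ) r x :=
    mdifferentiableAt_pi.2 fun i ↦ h _ (hF i)
  have hG : MDifferentiableAt I 𝓘(ℝ, (Fin n → ℝ) →L[ℝ] (Fin n → ℝ)) G x :=
    mdifferentiableAt_gramOperator hF1
  have hcG : ∀ y ∈ e.baseSet, c y = (G y).inverse (r y) := by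
    intro y hy
    have hi := gramOperator_isInvertible (hind y hy)
    have : r y = G y (c y) := by
      funext i
      rw [gramOperator_apply]
      simp only [r, c]
      rw [← Trivialization.eq_sum_localFrameCoeff_smul (I := I) (b := b) (s := s) hy]
    rw [this]
    exact (hi.inverse_apply_self _).symm
  have hc : MDifferentiableAt I 𝓘(ℝ, Fin n → ℝ) c x := by
    have hi := gramOperator_isInvertible (hind x hx)
    obtain ⟨A, hA⟩ := hi
    have hinv : DifferentiableAt ℝ ContinuousLinearMap.inverse (G x) := by
      change DifferentiableAt ℝ ContinuousLinearMap.inverse (gramOperator _)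
      rw [← hA]
      exact (contDiffAt_map_inverse (n := 1) A).differentiableAt one_ne_zero
    have := (hinv.mdifferentiableAt.comp x hG).clm_apply hr
    exact this.congr_of_eventuallyEq
      (Filter.eventuallyEq_of_mem (e.open_baseSet.mem_nhds hx) hcG)
  rw [mdifferentiableAt_iff_localFrameCoeff b hx]
  exact fun i ↦ mdifferentiableAt_pi.1 hc i

end MetricDual

section Curvature

variable {E : Type*} [NormedAddCommGroup E] [NormedSpace ℝ E] [FiniteDimensional ℝ E]
  {H : Type*} [TopologicalSpace H] {I : ModelWithCorners ℝ E H}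
  {M : Type*} [TopologicalSpace M] [ChartedSpace H M] [IsManifold I ∞ M]
  [RiemannianBundle (fun x : M ↦ TangentSpace I x)]
  [IsContMDiffRiemannianBundle I ∞ E (fun x : M ↦ TangentSpace I x)]
  {X Y Z V : Π x : M, TangentSpace I x} {x : M}

theorem mvfderiv_congr_of_eventuallyEq {f g : M → ℝ} (h : f =ᶠ[𝓝 x] g) :
    mvfderiv I f x = mvfderiv I g x := by
  ext v
  exact DFunLike.congr_fun h.mfderiv_eq v

theorem eventually_contMDiffAt_field (hX : ContMDiffAt I I.tangent 2 (T% X) x) :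
    ∀ᶠ y in 𝓝 x, ContMDiffAt I I.tangent 2 (T% X) y :=
  have : IsManifold I.tangent 2 (TangentBundle I M) := inferInstance
  (contMDiffAt_iff_contMDiffAt_nhds (by simp)).1 hX

theorem mdifferentiableAt_mlieBracket (hX : ContMDiffAt I I.tangent 2 (T% X) x)
    (hY : ContMDiffAt I I.tangent 2 (T% Y) x) : MDiffAt (T% (mlieBracket I X Y)) x := by
  have : CompleteSpace E := FiniteDimensional.complete ℝ E
  have : IsManifold I ((2 : ℕ∞) + 1) M :=
    IsManifold.of_le (n := ∞) (WithTop.coe_le_coe.2 (le_top : (2 + 1 : ℕ∞) ≤ ⊤))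
  have : IsManifold I (minSmoothness ℝ 2) M := by
    rw [minSmoothness_of_isRCLikeNormedField]
    infer_instance
  exact (ContMDiffAt.mlieBracket_vectorField (m := 1) (n := 2) hX hY
    (by simp; norm_num)).mdifferentiableAt one_ne_zero

theorem mdifferentiableAt_mvfderiv_inner (hX : ContMDiffAt I I.tangent 2 (T% X) x)
    (hY : ContMDiffAt I I.tangent 2 (T% Y) x) (hZ : ContMDiffAt I I.tangent 2 (T% Z) x) :
    MDifferentiableAt I 𝓘(ℝ, ℝ)
      (fun y ↦ mvfderiv I (fun z ↦ (inner ℝ (X z) (Y z) : ℝ)) y (Z y)) x :=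
  mdifferentiableAt_mvfderiv_apply (ContMDiffAt.inner_bundle (n := 2) hX hY)
    (hZ.mdifferentiableAt two_ne_zero)

theorem mdifferentiableAt_koszul (hX : ContMDiffAt I I.tangent 2 (T% X) x)
    (hY : ContMDiffAt I I.tangent 2 (T% Y) x) (hZ : ContMDiffAt I I.tangent 2 (T% Z) x) :
    MDifferentiableAt I 𝓘(ℝ, ℝ) (koszul I Y X Z) x := by
  have hX' := hX.mdifferentiableAt two_ne_zero
  have hY' := hY.mdifferentiableAt two_ne_zero
  have hZ' := hZ.mdifferentiableAt two_ne_zero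
  exact (((((mdifferentiableAt_mvfderiv_inner hY hZ hX).add
    (mdifferentiableAt_mvfderiv_inner hZ hX hY)).sub
    (mdifferentiableAt_mvfderiv_inner hX hY hZ)).add
    (mdiff_inner (mdifferentiableAt_mlieBracket hX hY) hZ')).sub
    (mdiff_inner (mdifferentiableAt_mlieBracket hY hZ) hX')).add
    (mdiff_inner (mdifferentiableAt_mlieBracket hZ hX) hY') |>.const_smul (1 / 2 : ℝ)

/-- The covariant derivative of a `C²` vector field along a `C²` vector field is differentiable. -/
theorem mdifferentiableAt_leviCivita (hX : ContMDiffAt I I.tangent 2 (T% X) x)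
    (hY : ContMDiffAt I I.tangent 2 (T% Y) x) :
    MDiffAt (T% fun y ↦ leviCivita I M Y y (X y)) x := by
  refine mdifferentiableAt_of_inner fun Z hZ ↦ ?_
  have hZ2 : ContMDiffAt I I.tangent 2 (T% Z) x := hZ.of_le ENat.LEInfty.out
  refine (mdifferentiableAt_koszul hX hY hZ2).congr_of_eventuallyEq ?_
  filter_upwards [eventually_contMDiffAt_field hX, eventually_contMDiffAt_field hY,
    eventually_contMDiffAt_field hZ2] with y hXy hYy hZy
  exact koszul_formula (hYy.mdifferentiableAt two_ne_zero) (hXy.mdifferentiableAt two_ne_zero)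
    (hZy.mdifferentiableAt two_ne_zero)

/-- Second derivatives of `⟨Z, V⟩` in terms of the Levi-Civita connection. -/
theorem mvfderiv_mvfderiv_inner (hX : ContMDiffAt I I.tangent 2 (T% X) x)
    (hY : ContMDiffAt I I.tangent 2 (T% Y) x) (hZ : ContMDiffAt I I.tangent 2 (T% Z) x)
    (hV : ContMDiffAt I I.tangent 2 (T% V) x) :
    mvfderiv I (fun y ↦ mvfderiv I (fun z ↦ (inner ℝ (Z z) (V z) : ℝ)) y (Y y)) x (X x) =
      inner ℝ (leviCivita I M (fun y ↦ leviCivita I M Z y (Y y)) x (X x)) (V x)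
        + inner ℝ (leviCivita I M Z x (Y x)) (leviCivita I M V x (X x))
        + (inner ℝ (leviCivita I M Z x (X x)) (leviCivita I M V x (Y x))
        + inner ℝ (Z x) (leviCivita I M (fun y ↦ leviCivita I M V y (Y y)) x (X x))) := by
  have hev : (fun y ↦ mvfderiv I (fun z ↦ (inner ℝ (Z z) (V z) : ℝ)) y (Y y)) =ᶠ[𝓝 x]
      fun y ↦ inner ℝ (leviCivita I M Z y (Y y)) (V y)
        + inner ℝ (Z y) (leviCivita I M V y (Y y)) := by
    filter_upwards [eventually_contMDiffAt_field hY, eventually_contMDiffAt_field hZ,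
      eventually_contMDiffAt_field hV] with y hYy hZy hVy
    exact leviCivita_metric (hYy.mdifferentiableAt two_ne_zero)
      (hZy.mdifferentiableAt two_ne_zero) (hVy.mdifferentiableAt two_ne_zero)
  have hX' := hX.mdifferentiableAt two_ne_zero
  have hZ' := hZ.mdifferentiableAt two_ne_zero
  have hV' := hV.mdifferentiableAt two_ne_zero
  have h1 := mdifferentiableAt_leviCivita hY hZ
  have h2 := mdifferentiableAt_leviCivita hY hV
  rw [mvfderiv_congr_of_eventuallyEq hev, mvfderiv_fun_add (mdiff_inner h1 hV')
    (mdiff_inner hZ' h2), add_apply, leviCivita_metric hX' h1 hV',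
    leviCivita_metric hX' hZ' h2]

/-- The curvature operator `R(X, Y)` is skew-symmetric. -/
theorem inner_curvature_left (hX : ContMDiffAt I I.tangent 2 (T% X) x)
    (hY : ContMDiffAt I I.tangent 2 (T% Y) x) (hZ : ContMDiffAt I I.tangent 2 (T% Z) x)
    (hV : ContMDiffAt I I.tangent 2 (T% V) x) :
    (inner ℝ (curvature I X Y Z x) (V x) : ℝ) = - inner ℝ (Z x) (curvature I X Y V x) := by
  have : CompleteSpace E := FiniteDimensional.complete ℝ E
  have h := mvfderiv_mlieBracket_apply (I := I) (f := fun z ↦ (inner ℝ (Z z) (V z) : ℝ))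
    (ContMDiffAt.inner_bundle (n := 2) hZ hV)
    (hX.mdifferentiableAt two_ne_zero) (hY.mdifferentiableAt two_ne_zero)
  rw [mvfderiv_mvfderiv_inner hX hY hZ hV, mvfderiv_mvfderiv_inner hY hX hZ hV,
    leviCivita_metric (mdifferentiableAt_mlieBracket hX hY)
      (hZ.mdifferentiableAt two_ne_zero) (hV.mdifferentiableAt two_ne_zero)] at h
  simp only [curvature, inner_sub_left, inner_sub_right]
  linarith

/-- The curvature of a vector field `V` whose covariant differential is skew-symmetric and
annihilates `V`. -/
theorem inner_curvature_of_skew (hX : ContMDiffAt I I.tangent 2 (T% X) x)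
    (hY : ContMDiffAt I I.tangent 2 (T% Y) x) (hV : ContMDiffAt I I.tangent 2 (T% V) x)
    (hskew : ∀ y, ∀ u w : TangentSpace I y,
      (inner ℝ (leviCivita I M V y u) w : ℝ) = - inner ℝ u (leviCivita I M V y w))
    (hVV : ∀ y, leviCivita I M V y (V y) = 0) (hYV : Y x = V x) :
    (inner ℝ (curvature I X Y V x) (X x) : ℝ) =
      inner ℝ (leviCivita I M V x (X x)) (leviCivita I M V x (X x)) := by
  have hX' := hX.mdifferentiableAt two_ne_zero
  have hY' := hY.mdifferentiableAt two_ne_zero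
  have hV' := hV.mdifferentiableAt two_ne_zero
  have hXV := mdifferentiableAt_leviCivita hX hV
  have hYV' := mdifferentiableAt_leviCivita hY hV
  have hXX : ∀ y, (inner ℝ (leviCivita I M V y (X y)) (X y) : ℝ) = 0 := fun y ↦ by
    have := hskew y (X y) (X y)
    have hc := real_inner_comm (X y) (leviCivita I M V y (X y))
    linarith
  have hVX : ∀ y, (inner ℝ (V y) (leviCivita I M V y (X y)) : ℝ) = 0 := fun y ↦ by
    have := hskew y (V y) (X y)
    rw [hVV, inner_zero_left] at this
    linarith
  have e1 := leviCivita_metric hX' hYV' hX'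
  have e2 := leviCivita_metric hY' hXV hX'
  have e3 := leviCivita_metric hX' hY' hXV
  have e4 := leviCivita_metric hX' hV' hXV
  have c1 : (fun y ↦ (inner ℝ (leviCivita I M V y (Y y)) (X y) : ℝ)) =
      fun y ↦ - inner ℝ (Y y) (leviCivita I M V y (X y)) := funext fun y ↦ hskew y _ _
  simp only [c1, hXX, hVX] at e1 e2 e4
  have e5 : mvfderiv I (fun y ↦ -(inner ℝ (Y y) (leviCivita I M V y (X y)) : ℝ)) x =
      - mvfderiv I (fun y ↦ (inner ℝ (Y y) (leviCivita I M V y (X y)) : ℝ)) x := mvfderiv_neg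
  rw [e5, neg_apply, e3, hYV, hVV, inner_zero_left] at e1
  rw [mvfderiv_const] at e2 e4
  simp only [zero_apply] at e2 e4
  have e6 : (inner ℝ (leviCivita I M V x (mlieBracket I X Y x)) (X x) : ℝ) =
      - inner ℝ (leviCivita I M Y x (X x)) (leviCivita I M V x (X x))
        + inner ℝ (leviCivita I M X x (Y x)) (leviCivita I M V x (X x)) := by
    rw [hskew, ← leviCivita_torsion_free hX' hY', inner_sub_left]
    ring
  have e7 := real_inner_comm (leviCivita I M X x (Y x)) (leviCivita I M V x (X x))
  simp only [curvature, inner_sub_left]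
  linarith

end Curvature

section RicciOfKilling

variable {E : Type*} [NormedAddCommGroup E] [NormedSpace ℝ E] [FiniteDimensional ℝ E]
  {H : Type*} [TopologicalSpace H] {I : ModelWithCorners ℝ E H}
  {M : Type*} [TopologicalSpace M] [ChartedSpace H M] [IsManifold I ∞ M]
  [RiemannianBundle (fun x : M ↦ TangentSpace I x)]
  [IsContMDiffRiemannianBundle I ∞ E (fun x : M ↦ TangentSpace I x)]
  {V : Π x : M, TangentSpace I x}

/-- The Ricci curvature in the direction of a vector field `V` whose covariant differential is
skew-symmetric and annihilates `V`. -/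
theorem ricci_of_skew (hV : IsSmoothField I V)
    (hskew : ∀ y, ∀ u w : TangentSpace I y,
      (inner ℝ (leviCivita I M V y u) w : ℝ) = - inner ℝ u (leviCivita I M V y w))
    (hVV : ∀ y, leviCivita I M V y (V y) = 0) (x : M) :
    ricci I x (V x) (V x) = ∑ i,
      (inner ℝ (leviCivita I M V x (stdOrthonormalBasis ℝ (TangentSpace I x) i))
        (leviCivita I M V x (stdOrthonormalBasis ℝ (TangentSpace I x) i)) : ℝ) := by
  refine Finset.sum_congr rfl fun i _ ↦ ?_
  have hext : ∀ v : TangentSpace I x,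
      ContMDiffAt I I.tangent 2 (T% (extend E v : Π y : M, TangentSpace I y)) x := fun v ↦
    contMDiffAt_extend ..
  have hV2 : ContMDiffAt I I.tangent 2 (T% V) x := (hV x).of_le ENat.LEInfty.out
  set u := stdOrthonormalBasis ℝ (TangentSpace I x) i
  have h1 := inner_curvature_left (hext u) (hext (V x)) (hext (V x)) (hext u)
  have h2 := inner_curvature_left (hext u) (hext (V x)) hV2 (hext u)
  have h3 := inner_curvature_of_skew (hext u) (hext (V x)) hV2 hskew hVV (extend_apply_self ..)
  rw [extend_apply_self] at h1 h2 h3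
  rw [extend_apply_self] at h1
  rw [h1, ← h2, h3]

end RicciOfKilling

section Submanifold

variable {E : Type*} [NormedAddCommGroup E] [NormedSpace ℝ E] [FiniteDimensional ℝ E]
  {H : Type*} [TopologicalSpace H] {I : ModelWithCorners ℝ E H}
  {N : Type*} [TopologicalSpace N] [ChartedSpace H N] [IsManifold I ∞ N]
  [RiemannianBundle (fun x : N ↦ TangentSpace I x)]
  [IsContMDiffRiemannianBundle I ∞ E (fun x : N ↦ TangentSpace I x)]
  {E' : Type*} [NormedAddCommGroup E'] [NormedSpace ℝ E'] [FiniteDimensional ℝ E']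
  {H' : Type*} [TopologicalSpace H'] {J : ModelWithCorners ℝ E' H'}
  {M : Type*} [TopologicalSpace M] [ChartedSpace H' M] [IsManifold J ∞ M]
  [RiemannianBundle (fun x : M ↦ TangentSpace J x)]
  [IsContMDiffRiemannianBundle J ∞ E' (fun x : M ↦ TangentSpace J x)]
  {ι : M → N}

theorem mvfderiv_inner_of_related (hι : IsRiemannianSubmanifold I J ι) {p : M}
    {Y Z : Π x : M, TangentSpace J x} {Y' Z' : Π x : N, TangentSpace I x}
    (hY' : MDiffAt (T% Y') (ι p)) (hZ' : MDiffAt (T% Z') (ι p))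
    (hYY' : ∀ᶠ y in 𝓝 p, mfderiv J I ι y (Y y) = Y' (ι y))
    (hZZ' : ∀ᶠ y in 𝓝 p, mfderiv J I ι y (Z y) = Z' (ι y)) (u : TangentSpace J p) :
    mvfderiv J (fun y ↦ (inner ℝ (Y y) (Z y) : ℝ)) p u =
      mvfderiv I (fun y ↦ (inner ℝ (Y' y) (Z' y) : ℝ)) (ι p) (mfderiv J I ι p u) := by
  have hev : (fun y ↦ (inner ℝ (Y y) (Z y) : ℝ)) =ᶠ[𝓝 p]
      (fun y ↦ (inner ℝ (Y' y) (Z' y) : ℝ)) ∘ ι := by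
    filter_upwards [hYY', hZZ'] with y hy hz
    rw [← hι.induced_metric, hy, hz]
    rfl
  rw [mvfderiv_congr_of_eventuallyEq hev]
  exact mvfderiv_comp_apply p (mdiff_inner hY' hZ')
    ((hι.immersion.contMDiff p).mdifferentiableAt (by simp)) u

/-- The Gauss formula: the Levi-Civita connection of a Riemannian submanifold is the tangential
part of the ambient connection. -/
theorem inner_leviCivita_of_related (hι : IsRiemannianSubmanifold I J ι) {p : M}
    {Y : Π x : M, TangentSpace J x} {Y' : Π x : N, TangentSpace I x}
    (hY : MDiffAt (T% Y) p) (hY' : MDiffAt (T% Y') (ι p))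
    (hYY' : ∀ᶠ y in 𝓝 p, mfderiv J I ι y (Y y) = Y' (ι y)) (u w : TangentSpace J p) :
    (inner ℝ (leviCivita J M Y p u) w : ℝ) =
      inner ℝ (leviCivita I N Y' (ι p) (mfderiv J I ι p u)) (mfderiv J I ι p w) := by
  have : CompleteSpace E := FiniteDimensional.complete ℝ E
  have : CompleteSpace E' := FiniteDimensional.complete ℝ E'
  obtain ⟨X, X', hX, hX', rfl, hXX'⟩ := exists_related_fields (hι.immersion.isImmersionAt p) u
  obtain ⟨Z, Z', hZ, hZ', rfl, hZZ'⟩ := exists_related_fields (hι.immersion.isImmersionAt p) w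
  have hι2 : ContMDiffAt J I 2 ι p := (hι.immersion.contMDiff p).of_le ENat.LEInfty.out
  rw [koszul_formula hY hX hZ, hXX'.self_of_nhds, hZZ'.self_of_nhds, koszul_formula hY' hX' hZ']
  simp only [koszul]
  rw [mvfderiv_inner_of_related hι hY' hZ' hYY' hZZ', mvfderiv_inner_of_related hι hZ' hX' hZZ' hXX',
    mvfderiv_inner_of_related hι hX' hY' hXX' hYY', ← hι.induced_metric, ← hι.induced_metric,
    ← hι.induced_metric, mfderiv_mlieBracket_of_related hι2 hX hY hX' hY' hXX' hYY',
    mfderiv_mlieBracket_of_related hι2 hY hZ hY' hZ' hYY' hZZ',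
    mfderiv_mlieBracket_of_related hι2 hZ hX hZ' hX' hZZ' hXX',
    hXX'.self_of_nhds, hYY'.self_of_nhds, hZZ'.self_of_nhds]

variable {A : AlmostContactMetricStructure I N} {β : N → ℝ}

theorem IsInvariantSubmanifold.inner_xi_right (hinv : IsInvariantSubmanifold J A ι)
    (hι : IsRiemannianSubmanifold I J ι) (p : M) (u : TangentSpace J p) :
    (inner ℝ u (hinv.xi p) : ℝ) = A.eta (ι p) (mfderiv J I ι p u) := by
  rw [← hι.induced_metric, hinv.mfderiv_xi, A.inner_xi]

theorem IsInvariantSubmanifold.inner_xi_self (hinv : IsInvariantSubmanifold J A ι)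
    (hι : IsRiemannianSubmanifold I J ι) (p : M) :
    (inner ℝ (hinv.xi p) (hinv.xi p) : ℝ) = 1 := by
  rw [hinv.inner_xi_right hι, hinv.mfderiv_xi, A.eta_xi]

/-- `∇_u ξ` is the tangential part of `-β φu` on an invariant submanifold of an SQ-Sasakian
manifold. -/
theorem IsInvariantSubmanifold.inner_leviCivita_xi (hinv : IsInvariantSubmanifold J A ι)
    (hA : A.IsSQSasakian β) (hι : IsRiemannianSubmanifold I J ι)
    (hξ : IsSmoothField J hinv.xi) (p : M) (u w : TangentSpace J p) :
    (inner ℝ (leviCivita J M hinv.xi p u) w : ℝ) =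
      -(β (ι p) * inner ℝ (A.phi (ι p) (mfderiv J I ι p u)) (mfderiv J I ι p w)) := by
  rw [inner_leviCivita_of_related hι ((hξ p).mdifferentiableAt (by simp))
    ((A.smooth_xi (ι p)).mdifferentiableAt (by simp))
    (Filter.Eventually.of_forall fun y ↦ hinv.mfderiv_xi y), hA.nabla_xi, inner_neg_left,
    real_inner_smul_left]

theorem IsInvariantSubmanifold.inner_leviCivita_xi_self (hinv : IsInvariantSubmanifold J A ι)
    (hA : A.IsSQSasakian β) (hι : IsRiemannianSubmanifold I J ι)
    (hξ : IsSmoothField J hinv.xi) (p : M) (u : TangentSpace J p) :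
    (inner ℝ (leviCivita J M hinv.xi p u) (leviCivita J M hinv.xi p u) : ℝ) =
      β (ι p) ^ 2 * (inner ℝ u u - inner ℝ u (hinv.xi p) ^ 2) := by
  obtain ⟨u', hu'⟩ := hinv.phi_tangent p u
  have h : leviCivita J M hinv.xi p u = -(β (ι p) • u') := by
    refine ext_inner_right ℝ fun w ↦ ?_
    rw [hinv.inner_leviCivita_xi hA hι hξ, ← hu', hι.induced_metric, inner_neg_left,
      real_inner_smul_left]
  rw [h, inner_neg_neg, real_inner_smul_left, real_inner_smul_right, ← hι.induced_metric, hu',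
    A.inner_phi_phi, hι.induced_metric, hinv.inner_xi_right hι]
  ring

/-- The Ricci curvature of an invariant submanifold of an SQ-Sasakian manifold in the direction
of the structure vector field. -/
theorem IsInvariantSubmanifold.ricci_xi (hinv : IsInvariantSubmanifold J A ι)
    (hA : A.IsSQSasakian β) (hι : IsRiemannianSubmanifold I J ι)
    (hξ : IsSmoothField J hinv.xi) (p : M) :
    ricci J p (hinv.xi p) (hinv.xi p) = (Module.finrank ℝ E' - 1) * β (ι p) ^ 2 := by
  rw [ricci_of_skew hξ ?_ ?_ p]
  · have h1 : ∑ i, (inner ℝ (stdOrthonormalBasis ℝ (TangentSpace J p) i) (hinv.xi p) : ℝ) ^ 2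
        = 1 := by
      have := (stdOrthonormalBasis ℝ (TangentSpace J p)).sum_sq_norm_inner_right (hinv.xi p)
      rw [← real_inner_self_eq_norm_sq, hinv.inner_xi_self hι] at this
      simpa using this
    have h2 : ∀ i, (inner ℝ (stdOrthonormalBasis ℝ (TangentSpace J p) i)
        (stdOrthonormalBasis ℝ (TangentSpace J p) i) : ℝ) = 1 := fun i ↦ by
      simp
    simp only [hinv.inner_leviCivita_xi_self hA hι hξ, h2]
    rw [← Finset.mul_sum, Finset.sum_sub_distrib, h1]
    have h3 : Module.finrank ℝ (TangentSpace J p) = Module.finrank ℝ E' := rfl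
    simp only [Finset.sum_const, Finset.card_univ, Fintype.card_fin, h3, nsmul_eq_mul, mul_one]
    ring
  · intro y u w
    have hu := hinv.inner_leviCivita_xi hA hι hξ y u w
    have hw := hinv.inner_leviCivita_xi hA hι hξ y w u
    rw [real_inner_comm] at hw
    rw [hu, hw, A.inner_phi_left, real_inner_comm]
    ring
  · intro y
    rw [← inner_self_eq_zero (𝕜 := ℝ), hinv.inner_leviCivita_xi_self hA hι hξ,
      hinv.inner_xi_self hι]
    ring

theorem IsRicciSoliton.eq_neg_ricci {V : Π x : M, TangentSpace J x} {lam : ℝ}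
    (h : IsRicciSoliton J V lam) (hV : ∀ p, (inner ℝ (V p) (V p) : ℝ) = 1) (p : M) :
    lam = - ricci J p (V p) (V p) := by
  have h1 := h.equation V V h.smooth h.smooth p
  have h2 : mlieBracket J V V p = 0 := by
    rw [mlieBracket, mlieBracketWithin_self]
    rfl
  simp only [lieDerivMetric, hV, h2, inner_zero_left, inner_zero_right] at h1
  rw [mvfderiv_const, zero_apply] at h1
  linarith

end Submanifold

end SQSasaki

end

theorem theorem4p2 (n m : ℕ)
    {N : Type*} [TopologicalSpace N] [T2Space N] [SecondCountableTopology N]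
    [ChartedSpace (EuclideanSpace ℝ (Fin (2 * n + 1))) N]
    [IsManifold (𝓡 (2 * n + 1)) ∞ N]
    [RiemannianBundle (fun x : N ↦ TangentSpace (𝓡 (2 * n + 1)) x)]
    [IsContMDiffRiemannianBundle (𝓡 (2 * n + 1)) ∞ (EuclideanSpace ℝ (Fin (2 * n + 1)))
      (fun x : N ↦ TangentSpace (𝓡 (2 * n + 1)) x)]
    (A : AlmostContactMetricStructure (𝓡 (2 * n + 1)) N) (β : N → ℝ)
    (hA : A.IsSQSasakian β)
    {M : Type*} [TopologicalSpace M] [T2Space M] [SecondCountableTopology M]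
    [ChartedSpace (EuclideanSpace ℝ (Fin (2 * m + 1))) M]
    [IsManifold (𝓡 (2 * m + 1)) ∞ M]
    [RiemannianBundle (fun x : M ↦ TangentSpace (𝓡 (2 * m + 1)) x)]
    [IsContMDiffRiemannianBundle (𝓡 (2 * m + 1)) ∞ (EuclideanSpace ℝ (Fin (2 * m + 1)))
      (fun x : M ↦ TangentSpace (𝓡 (2 * m + 1)) x)]
    (ι : M → N) (hι : IsRiemannianSubmanifold (𝓡 (2 * n + 1)) (𝓡 (2 * m + 1)) ι)
    (hinv : IsInvariantSubmanifold (𝓡 (2 * m + 1)) A ι)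
    (lam : ℝ) (hsol : IsRicciSoliton (𝓡 (2 * m + 1)) hinv.xi lam) :
    (∀ p : M, ricci (𝓡 (2 * m + 1)) p (hinv.xi p) (hinv.xi p) = 2 * (m : ℝ) * β (ι p) ^ 2) ∧
    (∀ p : M, lam = -2 * (m : ℝ) * β (ι p) ^ 2) ∧
    (1 ≤ m → (∃ p : M, β (ι p) ≠ 0) → lam < 0) := by
  have hric : ∀ p : M,
      ricci (𝓡 (2 * m + 1)) p (hinv.xi p) (hinv.xi p) = 2 * (m : ℝ) * β (ι p) ^ 2 := by
    intro p
    rw [hinv.ricci_xi hA hι hsol.smooth, finrank_euclideanSpace_fin]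
    push_cast
    ring
  have hlam : ∀ p : M, lam = -2 * (m : ℝ) * β (ι p) ^ 2 := by
    intro p
    rw [hsol.eq_neg_ricci (hinv.inner_xi_self hι) p, hric]
    ring
  refine ⟨hric, hlam, ?_⟩
  rintro hm ⟨p, hp⟩
  have hm' : (0 : ℝ) < m := by exact_mod_cast hm
  have hβ : 0 < β (ι p) ^ 2 := by positivity
  rw [hlam p]
  nlinarith [mul_pos hm' hβ]
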